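/- In the Musical Chairs game $MC(n,m)$ there are $m$ chairs, numbered $1,\dots,m$, and $n$ players $P_1,\dots,P_n$ who play as a team against a scheduler. Before the game each player $P_i$ chooses an infinite word $\pi_i=\pi_i[1]\pi_i[2]\cdots$ over the alphabet $\{1,\dots,m\}$ that is full, i.e. contains every letter of $\{1,\dots,m\}$. The scheduler then selects an index $k_i$ for each $i$, and the game starts with each $P_i$ occupying chair $\pi_i[k_i]$. A player is in conflict if some other player presently occupies the same chair. The game terminates as soon as no player is in conflict. As long as there are conflicts, in each round the scheduler selects an arbitrary nonempty set of players that are currently in conflict, and every selected player moves from its current position $\pi_i[k]$ to $\pi_i[k+1]$, while all other players stay in place. The choice of full words $\pi_1,\dots,\pi_n$ is a winning strategy for the team if, for every choice of the initial indices and for every strategy of the scheduler, the game terminates after finitely many rounds. **Theorem.** For all $n$ and $m$, the team of $n$ players has a winning strategy in the game $MC(n,m)$ if and only if $m\ge 2n-1$. -/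

import Mathlib

namespace MusicalChairs

/-- An infinite word on `m` chairs: the sequence of chairs that a player traverses. -/
abbrev Word (m : ℕ) : Type := ℕ → Fin m

/-- A word is full if every chair occurs in it. -/
def Word.IsFull {m : ℕ} (w : Word m) : Prop := ∀ c : Fin m, ∃ k : ℕ, w k = c

/-- A configuration of the game with `n` players: player `i` is at index `p i` of its word. -/
abbrev Config (n : ℕ) : Type := Fin n → ℕ

/-- Player `i` is in conflict if some other player presently occupies the same chair. -/
def InConflict {n m : ℕ} (π : Fin n → Word m) (p : Config n) (i : Fin n) : Prop :=
  ∃ j : Fin n, j ≠ i ∧ π j (p j) = π i (p i)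

/-- The game terminates as soon as no player is in conflict. -/
def IsTerminal {n m : ℕ} (π : Fin n → Word m) (p : Config n) : Prop :=
  ∀ i : Fin n, ¬ InConflict π p i

/-- One round of the game: the scheduler selects a nonempty set `S` of players, all of them
currently in conflict; exactly the players of `S` advance, each to the next letter of its word. -/
def IsRound {n m : ℕ} (π : Fin n → Word m) (p q : Config n) : Prop :=
  ∃ S : Finset (Fin n), S.Nonempty ∧ (∀ i ∈ S, InConflict π p i) ∧
    ∀ i : Fin n, q i = if i ∈ S then p i + 1 else p i

/-- A play of the game: the scheduler chooses the initial positions `P 0` arbitrarily, and as long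
as there are conflicts each configuration arises from the preceding one by a round. (After
termination nothing is required of the sequence.) As the players are deterministic, the plays are
the outcomes of the choices of initial positions and of strategies of the scheduler. -/
def IsPlay {n m : ℕ} (π : Fin n → Word m) (P : ℕ → Config n) : Prop :=
  ∀ t : ℕ, (∀ s ≤ t, ¬ IsTerminal π (P s)) → IsRound π (P t) (P (t + 1))

/-- A winning strategy for the team in the game with `n` players and `m` chairs: a choice of full
words such that, whatever the initial positions and the behaviour of the scheduler, the game
terminates after finitely many rounds. -/
def IsWinningStrategy {n m : ℕ} (π : Fin n → Word m) : Prop :=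
  (∀ i : Fin n, (π i).IsFull) ∧
    ∀ P : ℕ → Config n, IsPlay π P → ∃ t : ℕ, IsTerminal π (P t)

end MusicalChairs

namespace MusicalChairs

/-! Enough chairs: player `i` meets chair `r` only at multiples of a period (for `r > 0`), and the
periods, ordered by chair and then by player, grow by cubing. By induction on the number of players
in `K`, `sum_le_of_isSegment` bounds all moves of `K` when at least `2|K| - 1` chairs can be left
only after a conflict inside `K`. On the largest such chair `c` the smallest player `p` is by far
the most frequent visitor, so arrivals and departures of the others are rare. Between two of these,
either another player rests on `c`, which costs one player and one chair; or `p` soon reaches `c`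
and is stuck there, and while `p` rests anywhere the others have lost one player and at most two
chairs.

Too few chairs: extra chairs never hurt, so take `2n - 2` chairs, `n - 1` of each of two colours.
The obstruction is a parity argument in the style of Sperner's lemma. Start from a relative cycle
modulo two with exactly one monochromatic configuration. Replacing all configurations with a given
conflict by their successors keeps the relative cycle and the parity of the monochromatic ones
(`IsRelCycle.count_mono_subdivide`). Under a winning strategy this ends with terminal configurations
only; these use `n` distinct chairs, so none is monochromatic. -/

/-! ### Winning words for many chairs -/

/-- Amortisation: `f` gains at most `B` on a plateau of `g` and at most `k` in a step where `g`
grows, so each unit of `g` pays for `B + k`. -/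
theorem le_of_counter (f g : ℕ → ℕ) (a b B k : ℕ) (hab : a ≤ b)
    (hg : ∀ t, a ≤ t → t < b → g t ≤ g (t + 1))
    (hf : ∀ t, a ≤ t → t < b → f (t + 1) ≤ f t + k)
    (hB : ∀ a' b', a ≤ a' → a' ≤ b' → b' ≤ b → g a' = g b' → f b' ≤ f a' + B) :
    f b + g a * (B + k) ≤ f a + B + g b * (B + k) := by
  -- Here `a'` is the start of the plateau of `g` that contains `x`.
  have key : ∀ x, a ≤ x → x ≤ b → ∃ a', a ≤ a' ∧ a' ≤ x ∧ g a' = g x ∧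
      f a' + g a * (B + k) ≤ f a + g x * (B + k) := by
    intro x hx
    induction x, hx using Nat.le_induction with
    | base => intro _; exact ⟨a, le_rfl, le_rfl, rfl, le_rfl⟩
    | succ x hx ih =>
      intro hxb
      obtain ⟨a', h1, h2, h3, h4⟩ := ih (by omega)
      rcases (hg x hx (by omega)).eq_or_lt with h | h
      · exact ⟨a', h1, by omega, h3.trans h, by rw [← h]; exact h4⟩
      · refine ⟨x + 1, by omega, le_rfl, rfl, ?_⟩
        have h5 := hB a' x h1 h2 (by omega) h3
        have h6 := hf x hx (by omega)
        have h7 : (g x + 1) * (B + k) ≤ g (x + 1) * (B + k) := Nat.mul_le_mul_right _ h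
        rw [add_mul] at h7
        omega
  obtain ⟨a', h1, h2, h3, h4⟩ := key b hab le_rfl
  have h5 := hB a' b h1 h2 le_rfl h3
  omega

theorem exists_step (f : ℕ → ℕ) (a b u : ℕ) (hab : a ≤ b)
    (hf : ∀ t, a ≤ t → t < b → f (t + 1) ≤ f t + 1) (ha : f a ≤ u) (hb : u < f b) :
    ∃ t, a ≤ t ∧ t < b ∧ f t = u ∧ f (t + 1) = u + 1 := by
  induction b, hab using Nat.le_induction with
  | base => omega
  | succ b hab ih =>
    by_cases h : u < f b
    · obtain ⟨t, h1, h2, h3⟩ := ih (fun t h1 h2 => hf t h1 (by omega)) h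
      exact ⟨t, h1, by omega, h3⟩
    · have := hf b hab (by omega)
      exact ⟨b, hab, by omega, by omega, by omega⟩

/-! ### Periods and ruler words -/

/-- A rapidly growing sequence in which every term divides the next one. -/
def tower (n e : ℕ) : ℕ := (24 * (n + 1)) ^ 3 ^ e

theorem tower_succ (n e : ℕ) : tower n (e + 1) = tower n e ^ 3 := by
  rw [tower, tower, ← pow_mul, pow_succ]

theorem tower_pos (n e : ℕ) : 0 < tower n e := by unfold tower; positivity

theorem tower_dvd {n e e' : ℕ} (h : e ≤ e') : tower n e ∣ tower n e' :=
  pow_dvd_pow _ (Nat.pow_le_pow_right (by norm_num) h)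

theorem tower_mono {n e e' : ℕ} (h : e ≤ e') : tower n e ≤ tower n e' :=
  Nat.le_of_dvd (tower_pos _ _) (tower_dvd h)

theorem le_tower (n e : ℕ) : 24 * (n + 1) ≤ tower n e :=
  Nat.le_self_pow (by positivity) _

theorem tower_lt {n e e' : ℕ} (h : e < e') : tower n e < tower n e' := by
  refine Nat.pow_lt_pow_right (by omega) (Nat.pow_lt_pow_right (by norm_num) h)

/-- The number of `v < u` with `q ∣ v` or `q ∣ v + 1`, counted with multiplicity. -/
def passCount (q u : ℕ) : ℕ := u / q + (u + q - 1) / q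

theorem passCount_mono (q : ℕ) {u v : ℕ} (h : u ≤ v) : passCount q u ≤ passCount q v :=
  Nat.add_le_add (Nat.div_le_div_right h) (Nat.div_le_div_right (by omega))

/-- The second quotient is the ceiling of `u / q`: it jumps on leaving a multiple of `q`, while the
floor jumps on reaching one. -/
theorem passCount_lt {q u : ℕ} (hq : 0 < q) (h : q ∣ u ∨ q ∣ u + 1) :
    passCount q u < passCount q (u + 1) := by
  unfold passCount
  rcases h with h | h
  · have h1 : u / q ≤ (u + 1) / q := Nat.div_le_div_right (by omega)
    obtain ⟨d, rfl⟩ := h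
    have h2 : (q * d + q - 1) / q < d + 1 := by
      rw [Nat.div_lt_iff_lt_mul hq, add_mul, mul_comm d]; omega
    have h3 : (q * d + 1 + q - 1) / q = d + 1 := by
      rw [show q * d + 1 + q - 1 = q * (d + 1) by rw [mul_add]; omega]
      exact Nat.mul_div_cancel_left _ hq
    omega
  · have h1 : (u + q - 1) / q ≤ (u + 1 + q - 1) / q := Nat.div_le_div_right (by omega)
    obtain ⟨d, hd⟩ := h
    have h2 : u / q < d := by
      rw [Nat.div_lt_iff_lt_mul hq, mul_comm d]; omega
    have h3 : (u + 1) / q = d := by rw [hd]; exact Nat.mul_div_cancel_left _ hq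
    omega

theorem mul_div_add_le {Q q : ℕ} (hQ : 0 < Q) (h : Q ≤ q) (x d : ℕ) :
    Q * ((x + d) / q) ≤ Q * (x / q) + d + Q := by
  have h1 : (x + d) / q ≤ x / q + d / q + 1 := by
    rw [Nat.add_div (by omega)]; split_ifs <;> omega
  have h2 : Q * (d / q) ≤ d := (Nat.mul_le_mul_right _ h).trans (Nat.mul_div_le d q)
  calc Q * ((x + d) / q) ≤ Q * (x / q + d / q + 1) := Nat.mul_le_mul_left _ h1
    _ = Q * (x / q) + Q * (d / q) + Q := by ring
    _ ≤ _ := by omega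

theorem passCount_le {Q q : ℕ} (hQ : 0 < Q) (h : Q ≤ q) (x d : ℕ) :
    Q * passCount q (x + d) ≤ Q * passCount q x + 2 * d + 2 * Q := by
  unfold passCount
  have h1 := mul_div_add_le hQ h x d
  have h2 := mul_div_add_le hQ h (x + q - 1) d
  rw [show x + q - 1 + d = x + d + q - 1 by omega] at h2
  rw [mul_add, mul_add]
  omega

/-- The letter at index `t` of the word of player `i`: the largest `r ≤ M` such that `t` is
divisible by the `r`-th period of the player. -/
def rulerLetter (n M i t : ℕ) : ℕ := Nat.findGreatest (fun r => tower n (r * n + i) ∣ t) M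

theorem dvd_of_rulerLetter {n M i t c : ℕ} (hc : 0 < c) (h : rulerLetter n M i t = c) :
    tower n (c * n + i) ∣ t := by
  subst h
  exact Nat.findGreatest_of_ne_zero (P := fun r => tower n (r * n + i) ∣ t) rfl hc.ne'

theorem rulerLetter_eq {n M i t c : ℕ} (hc : c ≤ M) (h : tower n (c * n + i) ∣ t)
    (h' : ¬ tower n ((c + 1) * n + i) ∣ t) : rulerLetter n M i t = c := by
  refine le_antisymm ?_ (Nat.le_findGreatest hc h)
  by_contra! hlt
  have h1 := dvd_of_rulerLetter (n := n) (M := M) (i := i) (t := t) (by omega) rfl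
  refine h' ((tower_dvd ?_).trans h1)
  exact Nat.add_le_add_right (Nat.mul_le_mul_right _ hlt) _

theorem exists_rulerLetter_eq {n M c : ℕ} (hn : 0 < n) (i : ℕ) (hc : c ≤ M) (x : ℕ) :
    ∃ u, x ≤ u ∧ u < x + 2 * tower n (c * n + i) ∧ rulerLetter n M i u = c := by
  set q := tower n (c * n + i) with hq
  have hq0 : 0 < q := tower_pos _ _
  obtain ⟨d, hd1, hd2⟩ : ∃ d, x ≤ q * d ∧ q * d < x + q := by
    refine ⟨(x + q - 1) / q, ?_, ?_⟩
    · have := Nat.div_add_mod (x + q - 1) q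
      have := Nat.mod_lt (x + q - 1) hq0
      omega
    · have := Nat.mul_div_le (x + q - 1) q
      omega
  -- The next period exceeds `q`, so it cannot divide two consecutive multiples of `q`.
  by_cases h : tower n ((c + 1) * n + i) ∣ q * d
  · refine ⟨q * d + q, by omega, by omega, rulerLetter_eq hc ?_ ?_⟩
    · exact Dvd.dvd.add (dvd_mul_right _ _) dvd_rfl
    · intro h2
      have h3 := Nat.le_of_dvd hq0 ((Nat.dvd_add_right h).1 h2)
      have h4 : q < tower n ((c + 1) * n + i) := tower_lt (by rw [add_mul]; omega)
      omega
  · exact ⟨q * d, hd1, by omega, rulerLetter_eq hc (dvd_mul_right _ _) h⟩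

/-! ### Segments of a play and the bound on the number of moves -/

/-- On the time interval `[a, b)` every player of `K` stays or advances in each round, and when it
advances from a chair in `C`, it shares this chair with another player of `K`. -/
def IsSegment {n : ℕ} (w : Fin n → ℕ → ℕ) (K : Finset (Fin n)) (C : Finset ℕ)
    (P : ℕ → Config n) (a b : ℕ) : Prop :=
  ∀ t, a ≤ t → t < b → ∀ i ∈ K, P (t + 1) i = P t i ∨ (P (t + 1) i = P t i + 1 ∧
    (w i (P t i) ∈ C → ∃ j ∈ K, j ≠ i ∧ w j (P t j) = w i (P t i)))

namespace IsSegment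

variable {n : ℕ} {w : Fin n → ℕ → ℕ} {K : Finset (Fin n)} {C : Finset ℕ} {P : ℕ → Config n}
  {a b : ℕ}

theorem mono (h : IsSegment w K C P a b) {a' b' : ℕ} (ha : a ≤ a') (hb : b' ≤ b) :
    IsSegment w K C P a' b' :=
  fun t h1 h2 => h t (ha.trans h1) (h2.trans_le hb)

theorem le_succ (h : IsSegment w K C P a b) {t : ℕ} (h1 : a ≤ t) (h2 : t < b) {i : Fin n}
    (hi : i ∈ K) : P t i ≤ P (t + 1) i := by
  rcases h t h1 h2 i hi with h | h <;> omega

theorem succ_le (h : IsSegment w K C P a b) {t : ℕ} (h1 : a ≤ t) (h2 : t < b) {i : Fin n}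
    (hi : i ∈ K) : P (t + 1) i ≤ P t i + 1 := by
  rcases h t h1 h2 i hi with h | h <;> omega

theorem le (h : IsSegment w K C P a b) {t u : ℕ} (h1 : a ≤ t) (h2 : t ≤ u) (h3 : u ≤ b)
    {i : Fin n} (hi : i ∈ K) : P t i ≤ P u i := by
  induction u, h2 using Nat.le_induction with
  | base => rfl
  | succ u h2 ih => exact (ih (by omega)).trans (h.le_succ (by omega) (by omega) hi)

theorem sum_succ_le (h : IsSegment w K C P a b) {t : ℕ} (h1 : a ≤ t) (h2 : t < b)
    {S : Finset (Fin n)} (hS : S ⊆ K) : ∑ i ∈ S, P (t + 1) i ≤ ∑ i ∈ S, P t i + n := by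
  calc ∑ i ∈ S, P (t + 1) i ≤ ∑ i ∈ S, (P t i + 1) :=
        Finset.sum_le_sum fun i hi => h.succ_le h1 h2 (hS hi)
    _ = ∑ i ∈ S, P t i + S.card := by simp [Finset.sum_add_distrib]
    _ ≤ _ := by
      have := S.card_le_univ
      rw [Fintype.card_fin] at this
      omega

/-- If player `j` rests on chair `c` during a segment, then the other players play on without
this chair. -/
theorem erase (h : IsSegment w K C P a b) {j : Fin n} {C' : Finset ℕ} (hC : C' ⊆ C)
    (hj : ∀ t, a ≤ t → t < b → w j (P t j) ∉ C') : IsSegment w (K.erase j) C' P a b := by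
  intro t h1 h2 i hi
  refine (h t h1 h2 i (Finset.mem_of_mem_erase hi)).imp_right fun ⟨h3, h4⟩ => ⟨h3, fun h5 => ?_⟩
  obtain ⟨j', hj', hne, heq⟩ := h4 (hC h5)
  refine ⟨j', Finset.mem_erase.2 ⟨?_, hj'⟩, hne, heq⟩
  rintro rfl
  exact hj t h1 h2 (heq ▸ h5)

end IsSegment

/-- The bound for the moves of a set `K` of players in an interval in which the players other than
`p` neither reach nor leave the chair `c`. -/
theorem IsSegment.sum_le_of_forall_ne {n : ℕ} {w : Fin n → ℕ → ℕ} {K : Finset (Fin n)}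
    {C : Finset ℕ} {P : ℕ → Config n} {a b : ℕ} (hab : a ≤ b) (h : IsSegment w K C P a b)
    {p : Fin n} (hp : p ∈ K) {c s : ℕ} (hc : c ∈ C)
    (hs : ∀ x, ∃ u, x ≤ u ∧ u < x + 2 * s ∧ w p u = c)
    (hne : ∀ t, a ≤ t → t < b → ∀ j ∈ K.erase p, w j (P t j) ≠ c)
    (IH : ∀ x a' b', a' ≤ b' → IsSegment w (K.erase p) ((C.erase c).erase x) P a' b' →
      ∑ i ∈ K.erase p, P b' i ≤ ∑ i ∈ K.erase p, P a' i + s) :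
    ∑ i ∈ K, P b i ≤ ∑ i ∈ K, P a i + (s + 2 * s * (s + n + 1)) := by
  -- Within `2 * s` moves `p` meets `c`, and it cannot leave because no other player of `K` comes
  -- there.
  have hpm : P b p ≤ P a p + 2 * s := by
    by_contra! hlt
    obtain ⟨u, hu1, hu2, hu3⟩ := hs (P a p)
    obtain ⟨t, h1, h2, h3, h4⟩ := exists_step (fun t => P t p) a b u hab
      (fun t h1 h2 => h.succ_le h1 h2 hp) hu1 (by omega)
    rcases h t h1 h2 p hp with h5 | ⟨-, h5⟩
    · omega
    · obtain ⟨j, hj, hjp, heq⟩ := h5 (by rw [h3, hu3]; exact hc)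
      exact hne t h1 h2 j (Finset.mem_erase.2 ⟨hjp, hj⟩) (by rw [heq, h3, hu3])
  have hcount := le_of_counter (fun t => ∑ i ∈ K.erase p, P t i) (fun t => P t p) a b s n hab
    (fun t h1 h2 => h.le_succ h1 h2 hp)
    (fun t h1 h2 => h.sum_succ_le h1 h2 (Finset.erase_subset _ _)) ?_
  · rw [← Finset.sum_erase_add _ _ hp, ← Finset.sum_erase_add (a := p) _ _ hp]
    have h1 : P b p * (s + n) ≤ (P a p + 2 * s) * (s + n) := Nat.mul_le_mul_right _ hpm
    rw [add_mul] at h1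
    have h2 : 2 * s * (s + n + 1) = 2 * s * (s + n) + 2 * s := by ring
    omega
  · intro a' b' h1 h2 h3 h4
    -- The counter is the position of `p`, so on a plateau `p` rests on one chair, which is removed
    -- for the others.
    refine IH (w p (P a' p)) a' b' h2 ((h.mono h1 h3).erase ?_ ?_)
    · exact (Finset.erase_subset _ _).trans (Finset.erase_subset _ _)
    · intro t h5 h6
      have h7 := h.le h1 h5 (by omega) hp
      have h8 := h.le (by omega) h6.le h3 hp
      rw [show P t p = P a' p by omega]
      simp

/-- Removing the largest chair `c` leaves chairs below `c`, so the inductive bound `tower n (c * n)`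
is at most the period `s` of `p` on `c`; the other players' periods on `c` are at least `s ^ 3`,
which beats the quadratic bound `B`. -/
theorem sum_le_of_isSegment {n M : ℕ} {P : ℕ → Config n} (k : ℕ) :
    ∀ (K : Finset (Fin n)) (C : Finset ℕ) (r a b : ℕ), K.card = k → C ⊆ Finset.range r →
      r ≤ M + 1 → 2 * k ≤ C.card + 1 → a ≤ b →
      IsSegment (fun i : Fin n => rulerLetter n M i) K C P a b →
      ∑ i ∈ K, P b i ≤ ∑ i ∈ K, P a i + tower n (r * n) := by
  induction k with
  | zero =>
    intro K C r a b hK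
    simp [Finset.card_eq_zero.1 hK]
  | succ k ih =>
    intro K C r a b hK hCr hr hcard hab hseg
    have hKne : K.Nonempty := Finset.card_pos.1 (by omega)
    have hCne : C.Nonempty := Finset.card_pos.1 (by omega)
    obtain ⟨c, hc, hcmax⟩ : ∃ c ∈ C, ∀ d ∈ C, d ≤ c := ⟨_, C.max'_mem hCne, fun d hd => C.le_max' d hd⟩
    obtain ⟨p, hp, hpmin⟩ : ∃ p ∈ K, ∀ j ∈ K, p ≤ j := ⟨_, K.min'_mem hKne, fun d hd => K.min'_le d hd⟩
    have hcr : c < r := Finset.mem_range.1 (hCr hc)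
    have hCc : C.erase c ⊆ Finset.range c := fun d hd => by
      have h1 := hcmax d (Finset.mem_of_mem_erase hd)
      have h2 := Finset.ne_of_mem_erase hd
      simp; omega
    have hCcard := Finset.card_erase_of_mem hc
    have hn : 0 < n := p.pos
    set s := tower n (c * n + p) with hs
    have hTs : tower n (c * n) ≤ s := tower_mono (by omega)
    have hns : 24 * (n + 1) ≤ s := le_tower _ _
    set B := s + 2 * s * (s + n + 1) with hB
    have hBs : B ≤ 5 * s ^ 2 := by nlinarith
    have hQ : ∀ j ∈ K.erase p, 4 * (B + n) ≤ tower n (c * n + j) := by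
      intro j hj
      have h1 : (p : ℕ) < j :=
        lt_of_le_of_ne (hpmin j (Finset.mem_of_mem_erase hj))
          fun h => Finset.ne_of_mem_erase hj (Fin.ext h.symm)
      have h2 : s ^ 3 ≤ tower n (c * n + j) := by
        rw [hs, ← tower_succ]; exact tower_mono (by omega)
      refine le_trans ?_ h2
      nlinarith
    -- Letter `0` is also the default of `Nat.findGreatest` and so carries no divisibility; a second
    -- player forces at least three chairs, hence `c > 0`.
    have hc0 : ∀ j ∈ K.erase p, 0 < c := by
      intro j hj
      have h1 : 0 < (K.erase p).card := Finset.card_pos.2 ⟨j, hj⟩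
      rw [Finset.card_erase_of_mem hp] at h1
      have h2 := Finset.card_le_card hCc
      rw [Finset.card_range] at h2
      omega
    have hcardp : ∀ j ∈ K, (K.erase j).card = k := fun j hj => by
      rw [Finset.card_erase_of_mem hj]; omega
    set g : ℕ → ℕ := fun t => ∑ j ∈ K.erase p, passCount (tower n (c * n + j)) (P t j) with hg
    have hpc : ∀ t u, a ≤ t → t ≤ u → u ≤ b → ∀ j ∈ K.erase p,
        passCount (tower n (c * n + j)) (P t j) ≤ passCount (tower n (c * n + j)) (P u j) :=
      fun t u h1 h2 h3 j hj => passCount_mono _ (hseg.le h1 h2 h3 (Finset.mem_of_mem_erase hj))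
    have hcount := le_of_counter (fun t => ∑ i ∈ K, P t i) g a b B n hab
      (fun t h1 h2 => Finset.sum_le_sum (hpc t (t + 1) h1 (by omega) h2))
      (fun t h1 h2 => hseg.sum_succ_le h1 h2 subset_rfl) ?_
    · -- the exceptional moves are rare
      -- With `X` moves in all, `X ≤ B + (B + n) * Δg`, and this estimate of `Δg` gives `(B + n) *
      -- Δg ≤ X / 2 + 2 * n * (B + n)`; half of `X` is absorbed.
      have hg' : 4 * (B + n) * g b ≤ 4 * (B + n) * g a +
          2 * (∑ i ∈ K, P b i - ∑ i ∈ K, P a i) + 2 * n * (4 * (B + n)) := by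
        have h1 : ∑ i ∈ K, P b i - ∑ i ∈ K, P a i = ∑ i ∈ K, (P b i - P a i) :=
          (Finset.sum_tsub_distrib _ fun i hi => hseg.le le_rfl hab le_rfl hi).symm
        have h2 : ∑ i ∈ K.erase p, (P b i - P a i) ≤ ∑ i ∈ K, (P b i - P a i) :=
          Finset.sum_le_sum_of_subset (Finset.erase_subset _ _)
        have h3 : (K.erase p).card ≤ n := (Finset.card_le_univ _).trans_eq (Fintype.card_fin n)
        have h4 : 4 * (B + n) * g b ≤ ∑ j ∈ K.erase p,
            (4 * (B + n) * passCount (tower n (c * n + j)) (P a j) + 2 * (P b j - P a j) +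
              2 * (4 * (B + n))) := by
          rw [hg, Finset.mul_sum]
          refine Finset.sum_le_sum fun j hj => ?_
          have h5 := passCount_le (by omega) (hQ j hj) (P a j) (P b j - P a j)
          rwa [Nat.add_sub_cancel' (hseg.le le_rfl hab le_rfl (Finset.mem_of_mem_erase hj))] at h5
        rw [Finset.sum_add_distrib, Finset.sum_add_distrib, ← Finset.mul_sum, ← Finset.mul_sum,
          Finset.sum_const, smul_eq_mul] at h4
        have h5 : (K.erase p).card * (2 * (4 * (B + n))) ≤ n * (2 * (4 * (B + n))) :=
          Nat.mul_le_mul_right _ h3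
        have h6 : n * (2 * (4 * (B + n))) = 2 * n * (4 * (B + n)) := by ring
        rw [h1]
        simp only [hg] at h4 ⊢
        omega
      have hle : ∑ i ∈ K, P a i ≤ ∑ i ∈ K, P b i :=
        Finset.sum_le_sum fun i hi => hseg.le le_rfl hab le_rfl hi
      have hT : 2 * B + 4 * n * (B + n) ≤ tower n (r * n) := by
        have h2 : s ^ 3 ≤ tower n (r * n) := by
          rw [hs, ← tower_succ]
          refine tower_mono ?_
          have h1 : (c + 1) * n ≤ r * n := Nat.mul_le_mul_right _ hcr
          have h2 := p.2
          rw [add_mul] at h1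
          omega
        refine le_trans ?_ h2
        have h3 : B + n ≤ 6 * s ^ 2 := by nlinarith
        calc 2 * B + 4 * n * (B + n) ≤ 2 * (5 * s ^ 2) + 4 * n * (6 * s ^ 2) := by gcongr
          _ = (24 * n + 10) * s ^ 2 := by ring
          _ ≤ s * s ^ 2 := Nat.mul_le_mul_right _ (by omega)
          _ = s ^ 3 := by ring
      obtain ⟨d, hd⟩ := Nat.exists_eq_add_of_le hle
      rw [hd, Nat.add_sub_cancel_left] at hg'
      rw [hd] at hcount ⊢
      linarith
    · intro a' b' h1 h2 h3 hgeq
      have hseg' := hseg.mono h1 h3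
      -- As `g` is constant, so is each monotone summand: no player but `p` reaches or leaves `c`.
      have hquiet : ∀ t, a' ≤ t → t < b' → ∀ j ∈ K.erase p,
          P (t + 1) j = P t j ∨ rulerLetter n M j (P t j) ≠ c ∧ rulerLetter n M j (P (t + 1) j) ≠ c := by
        intro t h4 h5 j hj
        refine (hseg' t h4 h5 j (Finset.mem_of_mem_erase hj)).imp_right fun ⟨h6, _⟩ => ?_
        have h7 := (Finset.sum_eq_sum_iff_of_le (hpc a' b' h1 h2 h3)).1 hgeq j hj
        have h8 := hpc a' t h1 h4 (by omega) j hj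
        have h9 := hpc (t + 1) b' (by omega) h5 h3 j hj
        rw [h6] at h9
        constructor <;> intro h10 <;> have h11 := dvd_of_rulerLetter (hc0 j hj) h10
        · have := passCount_lt (tower_pos _ _) (Or.inl h11)
          omega
        · rw [h6] at h11
          have := passCount_lt (tower_pos _ _) (Or.inr h11)
          omega
      by_cases hsit : ∃ j ∈ K.erase p, rulerLetter n M j (P a' j) = c
      · obtain ⟨j, hj, hjc⟩ := hsit
        have hjK := Finset.mem_of_mem_erase hj
        have hstay : ∀ t, a' ≤ t → t ≤ b' → P t j = P a' j := by
          intro t h4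
          induction t, h4 using Nat.le_induction with
          | base => intro _; rfl
          | succ t h4 iht =>
            intro h5
            have h6 := iht (by omega)
            rcases hquiet t h4 h5 j hj with h7 | h7
            · omega
            · rw [h6] at h7; exact absurd hjc h7.1
        have h4 := ih (K.erase j) (C.erase c) c a' b' (hcardp j hjK) hCc (by omega) (by omega) h2
          (hseg'.erase (Finset.erase_subset _ _) fun t h4 h5 => by
            rw [hstay t h4 h5.le, hjc]; simp)
        rw [← Finset.sum_erase_add _ _ hjK, ← Finset.sum_erase_add (a := j) _ _ hjK,
          hstay b' h2 le_rfl]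
        omega
      · push Not at hsit
        refine hseg'.sum_le_of_forall_ne h2 hp hc
          (fun x => exists_rulerLetter_eq hn p (by omega) x) ?_ ?_
        · intro t h4
          induction t, h4 using Nat.le_induction with
          | base => intro _; exact hsit
          | succ t h4 iht =>
            intro h5 j hj
            rcases hquiet t h4 (by omega) j hj with h7 | h7
            · rw [h7]; exact iht (by omega) j hj
            · exact h7.2
        · intro x a'' b'' h4 h5
          have h6 := ih (K.erase p) ((C.erase c).erase x) c a'' b'' (hcardp p hp)
            ((Finset.erase_subset _ _).trans hCc) (by omega)
            (by have := Finset.pred_card_le_card_erase (s := C.erase c) (a := x); omega) h4 h5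
          omega

/-- With at least `2 * n - 1` chairs, the team wins with the ruler words. -/
theorem exists_isWinningStrategy {n m : ℕ} (h : 2 * n - 1 ≤ m) :
    ∃ π : Fin n → Word m, IsWinningStrategy π := by
  rcases Nat.eq_zero_or_pos n with rfl | hn
  · exact ⟨fun i => i.elim0, fun i => i.elim0, fun P _ => ⟨0, fun i => i.elim0⟩⟩
  obtain ⟨M, rfl⟩ : ∃ M, m = M + 1 := ⟨m - 1, by omega⟩
  refine ⟨fun i t => ⟨rulerLetter n M i t, Nat.lt_succ_of_le (Nat.findGreatest_le _)⟩, ?_, ?_⟩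
  · intro i c
    obtain ⟨u, -, -, hu⟩ := exists_rulerLetter_eq hn i (Nat.le_of_lt_succ c.2) 0
    exact ⟨u, Fin.ext hu⟩
  · intro P hP
    by_contra! hterm
    have hround := fun t => hP t fun s _ => hterm s
    have hseg : ∀ b, IsSegment (fun i : Fin n => rulerLetter n M i) Finset.univ
        (Finset.range (M + 1)) P 0 b := by
      intro b t _ _ i _
      obtain ⟨S, -, hS, hq⟩ := hround t
      by_cases hi : i ∈ S
      · right
        refine ⟨by rw [hq, if_pos hi], fun _ => ?_⟩
        obtain ⟨j, hj, heq⟩ := hS i hi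
        exact ⟨j, Finset.mem_univ _, hj, congrArg Fin.val heq⟩
      · left
        rw [hq, if_neg hi]
    have hgrow : ∀ t, t ≤ ∑ i, P t i := by
      intro t
      induction t with
      | zero => exact Nat.zero_le _
      | succ t ih =>
        obtain ⟨S, ⟨i, hi⟩, -, hq⟩ := hround t
        refine lt_of_le_of_lt ih (Finset.sum_lt_sum (fun j _ => ?_) ⟨i, Finset.mem_univ _, ?_⟩)
        · rw [hq]; split_ifs <;> omega
        · rw [hq, if_pos hi]; omega
    -- Every round costs a move, so this many rounds exceed the bound.
    have h1 := sum_le_of_isSegment n Finset.univ (Finset.range (M + 1)) (M + 1) 0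
      (∑ i, P 0 i + tower n ((M + 1) * n) + 1) (by simp) subset_rfl le_rfl
      (by rw [Finset.card_range]; omega) (Nat.zero_le _) (hseg _)
    have h2 := hgrow (∑ i, P 0 i + tower n ((M + 1) * n) + 1)
    omega

/-! ### Too few chairs: reduction to `2 * n - 2` chairs -/

/-- A winning strategy stays winning when a new chair is put in front of every word. -/
theorem IsWinningStrategy.exists_succ {n m : ℕ} {π : Fin n → Word m} (h : IsWinningStrategy π) :
    ∃ π' : Fin n → Word (m + 1), IsWinningStrategy π' := by
  let π' : Fin n → Word (m + 1) := fun i k =>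
    Nat.casesOn k (Fin.last m) fun k => (π i k).castSucc
  refine ⟨π', fun i c => ?_, fun P hP => ?_⟩
  · induction c using Fin.lastCases with
    | last => exact ⟨0, rfl⟩
    | cast c =>
      obtain ⟨k, rfl⟩ := h.1 i c
      exact ⟨k + 1, rfl⟩
  · by_contra! hterm
    have hround := fun t => hP t fun s _ => hterm s
    have hstep : ∀ i t, P t i ≤ P (t + 1) i := by
      intro i t
      obtain ⟨S, -, -, hq⟩ := hround t
      rw [hq]; split_ifs <;> omega
    have hmono : ∀ i, Monotone fun t => P t i := fun i => monotone_nat_of_le_succ (hstep i)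
    have hT : ∀ i, ∃ T, (∃ t, P t i ≠ 0) → P T i ≠ 0 := by
      intro i
      by_cases hi : ∃ t, P t i ≠ 0
      · exact ⟨hi.choose, fun _ => hi.choose_spec⟩
      · exact ⟨0, fun h => absurd h hi⟩
    choose T hT using hT
    have hU : ∀ i t, P t i ≠ 0 → ∀ s, P (s + Finset.univ.sup T) i ≠ 0 := by
      intro i t ht s
      have h1 := hT i ⟨t, ht⟩
      have h2 : P (T i) i ≤ P (s + Finset.univ.sup T) i :=
        hmono i ((Finset.le_sup (Finset.mem_univ i)).trans (Nat.le_add_left _ _))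
      omega
    set U := Finset.univ.sup T
    -- From time `U` on, players still on the new chair never move, and movers conflict only with
    -- players on old chairs. Truncated subtraction puts the resting players at index `0` of their
    -- old words, which can only add conflicts.
    have hQ : ∀ t, IsRound π (fun i => P (t + U) i - 1) (fun i => P (t + 1 + U) i - 1) := by
      intro t
      obtain ⟨S, hne, hS, hq⟩ := hround (t + U)
      have hpos : ∀ i ∈ S, P (t + U) i ≠ 0 := by
        intro i hi
        refine hU i (t + U + 1) ?_ t
        rw [hq, if_pos hi]; omega
      refine ⟨S, hne, fun i hi => ?_, fun i => ?_⟩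
      · obtain ⟨j, hj, heq⟩ := hS i hi
        refine ⟨j, hj, ?_⟩
        change π j (P (t + U) j - 1) = π i (P (t + U) i - 1)
        obtain ⟨a, ha⟩ := Nat.exists_eq_succ_of_ne_zero (hpos i hi)
        rw [ha] at heq ⊢
        rcases hb : P (t + U) j with _ | b
        · rw [hb] at heq
          exact absurd heq (Fin.castSucc_lt_last _).ne'
        · rw [hb] at heq
          exact Fin.castSucc_injective m heq
      · change P (t + 1 + U) i - 1 = if i ∈ S then P (t + U) i - 1 + 1 else P (t + U) i - 1
        rw [show t + 1 + U = t + U + 1 by omega, hq]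
        split_ifs with hi
        · have := hpos i hi; omega
        · rfl
    obtain ⟨t, ht⟩ := h.2 (fun t i => P (t + U) i - 1) fun t _ => hQ t
    obtain ⟨S, ⟨i, hi⟩, hS, -⟩ := hQ t
    exact ht i (hS i hi)

theorem exists_isWinningStrategy_of_le {n m m' : ℕ} (hm : m ≤ m')
    (h : ∃ π : Fin n → Word m, IsWinningStrategy π) :
    ∃ π : Fin n → Word m', IsWinningStrategy π := by
  induction m', hm using Nat.le_induction with
  | base => exact h
  | succ m' _ ih =>
    obtain ⟨π, hπ⟩ := ih
    exact hπ.exists_succ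

/-! ### Too few chairs: counting configurations modulo two -/

/-- A set of configurations, considered modulo two. -/
abbrev Chain (n : ℕ) : Type := Config n →₀ ZMod 2

/-- The number modulo two of the configurations of a chain, weighted by `φ`. -/
noncomputable abbrev count {n : ℕ} (φ : Config n → ZMod 2) : Chain n →ₗ[ZMod 2] ZMod 2 :=
  Finsupp.linearCombination (ZMod 2) φ

theorem count_add {n : ℕ} (φ ψ : Config n → ZMod 2) (C : Chain n) :
    count (φ + ψ) C = count φ C + count ψ C := by
  simp [Finsupp.linearCombination_apply, Finsupp.sum, mul_add, Finset.sum_add_distrib]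

/-- Player `i` advances. -/
def advance {n : ℕ} (i : Fin n) (p : Config n) : Config n := Function.update p i (p i + 1)

@[simp] theorem advance_self {n : ℕ} (i : Fin n) (p : Config n) : advance i p i = p i + 1 := by
  simp [advance]

@[simp] theorem advance_of_ne {n : ℕ} {i j : Fin n} (h : j ≠ i) (p : Config n) :
    advance i p j = p j := by
  simp [advance, h]

section Subdivision

variable {n m : ℕ} (π : Fin n → Word m)

open Classical in
/-- The indicator of the configurations that agree with `q` for all players but `s`. -/
noncomputable def face (s : Fin n) (q p : Config n) : ZMod 2 := if ∀ t, t ≠ s → p t = q t then 1 else 0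

/-- Every face of the chain with a conflict is contained in an even number of configurations. -/
def IsRelCycle (C : Chain n) : Prop :=
  ∀ s q, (∃ i j, i ≠ s ∧ j ≠ s ∧ i ≠ j ∧ π i (q i) = π j (q j)) → count (face s q) C = 0

theorem face_update (s : Fin n) (q p : Config n) (x : ℕ) :
    face s q (Function.update p s x) = face s q p := by
  unfold face
  congr 1
  refine propext (forall_congr' fun t => forall_congr' fun ht => ?_)
  rw [Function.update_of_ne ht]

variable {π}

/-- In a relative cycle, a weight that does not depend on player `s` and is supported on
configurations with a fixed conflict among the other players has vanishing count. -/
theorem IsRelCycle.count_eq_zero {C : Chain n} (hC : IsRelCycle π C) {φ : Config n → ZMod 2}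
    {s i j : Fin n} (hi : i ≠ s) (hj : j ≠ s) (hij : i ≠ j)
    (hφ : ∀ p x, φ (Function.update p s x) = φ p)
    (hc : ∀ p, φ p ≠ 0 → π i (p i) = π j (p j)) : count φ C = 0 := by
  classical
  -- Configurations are grouped by their face opposite `s`, represented by setting the index of `s`
  -- to `0`.
  have h1 : count φ C = ∑ q ∈ C.support.image fun p => Function.update p s 0,
      φ q * count (face s q) C := by
    simp only [Finsupp.linearCombination_apply, Finsupp.sum, smul_eq_mul, Finset.mul_sum]
    rw [Finset.sum_comm]
    refine Finset.sum_congr rfl fun p hp => ?_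
    rw [Finset.sum_eq_single (Function.update p s 0)]
    · rw [hφ, face, if_pos]
      · ring
      · intro t ht
        rw [Function.update_of_ne ht]
    · intro q hq hne
      obtain ⟨p', -, rfl⟩ := Finset.mem_image.1 hq
      rw [face, if_neg]
      · ring
      · intro h
        refine hne (funext fun t => ?_)
        by_cases ht : t = s
        · subst ht; simp
        · rw [← h t ht, Function.update_of_ne ht]
    · intro h
      exact absurd (Finset.mem_image_of_mem _ hp) h
  rw [h1]
  refine Finset.sum_eq_zero fun q _ => ?_
  by_cases hq : φ q = 0
  · rw [hq, zero_mul]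
  · rw [hC s q ⟨i, j, hi, hj, hij, hc q hq⟩, mul_zero]

/-! ### Subdivision at a conflict -/

/-- The sum of `φ` over the configurations obtained from `p` when a subset of the players `i`, `j`
advances, provided that these two players are at the indices `k`, `l`. -/
def cornerSum (i j : Fin n) (k l : ℕ) (φ : Config n → ZMod 2) (p : Config n) : ZMod 2 :=
  if p i = k ∧ p j = l then
    φ p + φ (advance i p) + φ (advance j p) + φ (advance i (advance j p)) else 0

/-- Every configuration with players `i`, `j` at the indices `k`, `l` is replaced by the three
configurations in which at least one of these two players has advanced. -/
noncomputable def subdivide (i j : Fin n) (k l : ℕ) : Chain n →ₗ[ZMod 2] Chain n :=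
  Finsupp.linearCombination (ZMod 2) fun p =>
    if p i = k ∧ p j = l then
      Finsupp.single (advance i p) 1 + Finsupp.single (advance j p) 1 +
        Finsupp.single (advance i (advance j p)) 1
    else Finsupp.single p 1

theorem count_subdivide (i j : Fin n) (k l : ℕ) (φ : Config n → ZMod 2) (C : Chain n) :
    count φ (subdivide i j k l C) = count φ C + count (cornerSum i j k l φ) C := by
  have h : count φ ∘ₗ subdivide i j k l = count φ + count (cornerSum i j k l φ) := by
    ext p
    simp only [subdivide, cornerSum, LinearMap.comp_apply, LinearMap.add_apply,
      Finsupp.lsingle_apply, Finsupp.linearCombination_single, one_smul]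
    split_ifs
    · simp only [map_add, Finsupp.linearCombination_single, one_smul]
      linear_combination -(CharTwo.add_self_eq_zero (φ p))
    · simp
  exact LinearMap.congr_fun h C

theorem cornerSum_eq_zero_left {i j : Fin n} (hij : i ≠ j) {k l : ℕ} {φ : Config n → ZMod 2}
    (h1 : ∀ p, p i = k → φ (advance i p) = φ p) : cornerSum i j k l φ = 0 := by
  funext p
  unfold cornerSum
  split_ifs with h
  · rw [h1 p h.1, h1 (advance j p) (by rw [advance_of_ne hij]; exact h.1),
      CharTwo.add_self_eq_zero, zero_add, CharTwo.add_self_eq_zero]; rfl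
  · rfl

theorem advance_comm {i j : Fin n} (hij : i ≠ j) (p : Config n) :
    advance i (advance j p) = advance j (advance i p) := by
  funext t
  by_cases h1 : t = i
  · subst h1; simp [hij]
  · by_cases h2 : t = j
    · subst h2; simp [h1]
    · simp [h1, h2]

theorem cornerSum_eq_zero_right {i j : Fin n} (hij : i ≠ j) {k l : ℕ} {φ : Config n → ZMod 2}
    (h1 : ∀ p, p j = l → φ (advance j p) = φ p) : cornerSum i j k l φ = 0 := by
  rw [← cornerSum_eq_zero_left hij.symm (k := l) (l := k) h1]
  funext p
  unfold cornerSum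
  rw [advance_comm hij]
  by_cases h : p i = k ∧ p j = l
  · rw [if_pos h, if_pos h.symm]; ring
  · rw [if_neg h, if_neg fun h' => h h'.symm]

theorem advance_update {i s : Fin n} (h : i ≠ s) (p : Config n) (x : ℕ) :
    advance i (Function.update p s x) = Function.update (advance i p) s x := by
  rw [advance, advance, Function.update_of_ne h, Function.update_comm h]

theorem cornerSum_update {i j s : Fin n} (hi : i ≠ s) (hj : j ≠ s) (k l : ℕ)
    {φ : Config n → ZMod 2} (hφ : ∀ p x, φ (Function.update p s x) = φ p) (p : Config n) (x : ℕ) :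
    cornerSum i j k l φ (Function.update p s x) = cornerSum i j k l φ p := by
  unfold cornerSum
  rw [advance_update hj, advance_update hi, advance_update hi, Function.update_of_ne hi,
    Function.update_of_ne hj, hφ, hφ, hφ, hφ]

theorem conflict_of_cornerSum_ne_zero {i j : Fin n} {k l : ℕ} (hkl : π i k = π j l)
    {φ : Config n → ZMod 2} {p : Config n} (h : cornerSum i j k l φ p ≠ 0) :
    π i (p i) = π j (p j) := by
  unfold cornerSum at h
  split_ifs at h with h1
  · rw [h1.1, h1.2, hkl]
  · exact absurd rfl h

/-- If `s` is `i` or `j`, the four corners cancel in pairs; otherwise the correction does not depend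
on `s` and sees the conflict of `i` and `j`. -/
theorem IsRelCycle.subdivide {C : Chain n} (hC : IsRelCycle π C) {i j : Fin n} (hij : i ≠ j)
    {k l : ℕ} (hkl : π i k = π j l) : IsRelCycle π (subdivide i j k l C) := by
  intro s q hq
  rw [count_subdivide, hC s q hq, zero_add]
  by_cases hi : i = s
  · subst hi
    rw [cornerSum_eq_zero_left hij fun p _ => face_update _ _ _ _]
    simp
  by_cases hj : j = s
  · subst hj
    rw [cornerSum_eq_zero_right hij fun p _ => face_update _ _ _ _]
    simp
  exact hC.count_eq_zero hi hj hij (cornerSum_update hi hj k l (face_update s q))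
    fun p => conflict_of_cornerSum_ne_zero hkl

variable (π) in
open Classical in
/-- The indicator of the configurations with players `i`, `j` at the indices `k`, `l`, in which
the colours of the chairs of the other players are prescribed. -/
noncomputable def pattern (col : Fin m → Bool) (i j : Fin n) (k l : ℕ) (β : Fin n → Bool) (p : Config n) :
    ZMod 2 :=
  if (p i = k ∧ p j = l) ∧ ∀ t, t ≠ i → t ≠ j → col (π t (p t)) = β t then 1 else 0

theorem IsRelCycle.count_pattern_update {C : Chain n} (hC : IsRelCycle π C) (col : Fin m → Bool)
    {i j : Fin n} (hij : i ≠ j) {k l : ℕ} (hkl : π i k = π j l) (β : Fin n → Bool) {s : Fin n}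
    (hi : i ≠ s) (hj : j ≠ s) (b : Bool) :
    count (pattern π col i j k l (Function.update β s b)) C = count (pattern π col i j k l β) C := by
  classical
  by_cases hb : b = β s
  · rw [hb, Function.update_eq_self]
  -- The two colours for `s` exhaust all cases, so the sum forgets player `s`.
  have hsum : pattern π col i j k l (Function.update β s b) + pattern π col i j k l β =
      fun p => if (p i = k ∧ p j = l) ∧ ∀ t, t ≠ i → t ≠ j → t ≠ s → col (π t (p t)) = β t
        then 1 else 0 := by
    have hiff : ∀ (γ : Fin n → Bool) (p : Config n), (∀ t, t ≠ s → γ t = β t) →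
        ((∀ t, t ≠ i → t ≠ j → col (π t (p t)) = γ t) ↔
          (∀ t, t ≠ i → t ≠ j → t ≠ s → col (π t (p t)) = β t) ∧ col (π s (p s)) = γ s) := by
      intro γ p hγ
      refine ⟨fun h => ⟨fun t h1 h2 h3 => (h t h1 h2).trans (hγ t h3), h s hi.symm hj.symm⟩,
        fun h t h1 h2 => ?_⟩
      by_cases hts : t = s
      · rw [hts, h.2]
      · rw [h.1 t h1 h2 hts, hγ t hts]
    funext p
    simp only [Pi.add_apply, pattern]
    simp only [hiff β p fun _ _ => rfl,
      hiff (Function.update β s b) p fun t ht => Function.update_of_ne ht _ _,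
      Function.update_self]
    have hcol : col (π s (p s)) = b ↔ ¬ col (π s (p s)) = β s := by
      revert hb
      cases b <;> cases β s <;> cases col (π s (p s)) <;> simp
    by_cases hs : col (π s (p s)) = β s <;> simp [hs, hcol, Ne.symm hb]
  have h0 : count (pattern π col i j k l (Function.update β s b) + pattern π col i j k l β) C = 0 := by
    rw [hsum]
    refine hC.count_eq_zero hi hj hij (fun p x => ?_) fun p hp => ?_
    · rw [Function.update_of_ne hi, Function.update_of_ne hj]
      congr 1
      refine propext (and_congr_right fun _ => forall_congr' fun t => forall_congr' fun _ =>
        forall_congr' fun _ => forall_congr' fun ht => ?_)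
      rw [Function.update_of_ne ht]
    · rw [ne_eq, ite_eq_right_iff, Classical.not_imp] at hp
      rw [hp.1.1.1, hp.1.1.2, hkl]
  rw [count_add] at h0
  exact CharTwo.add_eq_zero.1 h0

/-! ### Parity of the monochromatic configurations -/

variable (π) in
open Classical in
/-- The indicator of the configurations in which all chairs in use have the same colour. -/
noncomputable def mono (col : Fin m → Bool) (p : Config n) : ZMod 2 :=
  if ∃ b, ∀ t, col (π t (p t)) = b then 1 else 0

theorem mono_advance {col : Fin m → Bool} {i : Fin n} {p : Config n}
    (h : col (π i (p i + 1)) = col (π i (p i))) : mono π col (advance i p) = mono π col p := by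
  unfold mono
  congr 1
  refine propext (exists_congr fun b => forall_congr' fun t => ?_)
  by_cases ht : t = i
  · subst ht; rw [advance_self, h]
  · rw [advance_of_ne ht]

theorem mono_eq_zero {col : Fin m → Bool} {p : Config n} {i j : Fin n}
    (h : col (π i (p i)) ≠ col (π j (p j))) : mono π col p = 0 := by
  refine if_neg ?_
  rintro ⟨b, hb⟩
  exact h ((hb i).trans (hb j).symm)

theorem mono_eq_pattern {col : Fin m → Bool} {p : Config n} {i j : Fin n} {k l : ℕ} {b : Bool}
    (hp : p i = k ∧ p j = l) {p' : Config n} (hp' : ∀ t, t ≠ i → t ≠ j → p' t = p t)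
    (hi : col (π i (p' i)) = b) (hj : col (π j (p' j)) = b) :
    mono π col p' = pattern π col i j k l (fun _ => b) p := by
  unfold mono pattern
  congr 1
  refine propext ⟨?_, ?_⟩
  · rintro ⟨b', hb'⟩
    refine ⟨hp, fun t h1 h2 => ?_⟩
    rw [← hp' t h1 h2, hb', ← hi, hb']
  · rintro ⟨-, h⟩
    refine ⟨b, fun t => ?_⟩
    by_cases h1 : t = i
    · rw [h1, hi]
    by_cases h2 : t = j
    · rw [h2, hj]
    rw [hp' t h1 h2, h t h1 h2]

/-- The prescribed colours are switched one player at a time. -/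
theorem IsRelCycle.count_pattern_const {C : Chain n} (hC : IsRelCycle π C) (col : Fin m → Bool)
    {i j : Fin n} (hij : i ≠ j) {k l : ℕ} (hkl : π i k = π j l) (b b' : Bool) :
    count (pattern π col i j k l fun _ => b') C = count (pattern π col i j k l fun _ => b) C := by
  classical
  have h : ∀ F : Finset (Fin n), i ∉ F → j ∉ F →
      count (pattern π col i j k l fun t => if t ∈ F then b' else b) C =
        count (pattern π col i j k l fun _ => b) C := by
    intro F
    induction F using Finset.induction_on with
    | empty => intro _ _; simp
    | insert s F hs ih =>
      intro hi hj
      rw [Finset.mem_insert, not_or] at hi hj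
      refine Eq.trans ?_ ((hC.count_pattern_update col hij hkl _ hi.1 hj.1 b').trans
        (ih hi.2 hj.2))
      congr 3
      funext t
      by_cases ht : t = s
      · subst ht; simp
      · simp [ht]
  rw [← h ((Finset.univ.erase i).erase j) (by simp) (by simp)]
  congr 2
  funext p
  unfold pattern
  congr 1
  refine propext (and_congr_right fun _ => forall_congr' fun t => forall_congr' fun h1 =>
    forall_congr' fun h2 => ?_)
  simp [h1, h2]

/-- Subdivision along a conflict preserves the number of monochromatic configurations. -/
theorem IsRelCycle.count_mono_subdivide {C : Chain n} (hC : IsRelCycle π C) (col : Fin m → Bool)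
    {i j : Fin n} (hij : i ≠ j) {k l : ℕ} (hkl : π i k = π j l) :
    count (mono π col) (MusicalChairs.subdivide i j k l C) = count (mono π col) C := by
  rw [count_subdivide, add_eq_left]
  by_cases h1 : col (π i (k + 1)) = col (π i k)
  · rw [cornerSum_eq_zero_left hij]
    · simp
    · rintro p rfl
      exact mono_advance h1
  by_cases h2 : col (π j (l + 1)) = col (π j l)
  · rw [cornerSum_eq_zero_right hij]
    · simp
    · rintro p rfl
      exact mono_advance h2
  -- Both players change colour. If only one of them advances, their colours differ; so only the two
  -- corners where none or both advance contribute, with opposite colours.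
  have h3 : cornerSum i j k l (mono π col) = pattern π col i j k l (fun _ => col (π i k)) +
      pattern π col i j k l (fun _ => !col (π i k)) := by
    funext p
    unfold cornerSum
    split_ifs with hp
    · obtain ⟨rfl, rfl⟩ := hp
      rw [mono_eq_pattern (⟨rfl, rfl⟩ : p i = p i ∧ p j = p j) (fun _ _ _ => rfl) rfl (by rw [hkl]),
        mono_eq_zero (p := advance i p) (i := i) (j := j),
        mono_eq_zero (p := advance j p) (i := j) (j := i),
        mono_eq_pattern (p' := advance i (advance j p)) (b := !col (π i (p i)))
          (⟨rfl, rfl⟩ : p i = p i ∧ p j = p j)]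
      · simp
      · intro t hi hj; simp [hi, hj]
      · simpa [hij, Bool.eq_not] using h1
      · rw [hkl]; simpa [hij.symm, Bool.eq_not] using h2
      · simpa [hij, hkl] using h2
      · simpa [hij.symm, hkl] using h1
    · simp [pattern, hp]
  rw [h3, count_add, hC.count_pattern_const col hij hkl (col (π i k)) (!col (π i k)), CharTwo.add_self_eq_zero]

/-! ### Subdividing until all configurations are terminal -/

/-- The configurations reached from one another by rounds are well-founded. -/
theorem IsWinningStrategy.wellFounded (h : IsWinningStrategy π) :
    WellFounded fun q p : Config n => IsRound π p q := by
  rw [wellFounded_iff_isEmpty_descending_chain]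
  refine ⟨fun ⟨P, hP⟩ => ?_⟩
  obtain ⟨t, ht⟩ := h.2 P fun t _ => hP t
  obtain ⟨S, ⟨i, hi⟩, hS, -⟩ := hP t
  exact ht i (hS i hi)

theorem isRound_advance {p : Config n} {i : Fin n} (h : InConflict π p i) :
    IsRound π p (advance i p) := by
  refine ⟨{i}, by simp, by simpa using h, fun t => ?_⟩
  by_cases ht : t = i
  · subst ht; simp
  · simp [ht]

theorem isRound_advance_advance {p : Config n} {i j : Fin n} (hij : i ≠ j)
    (hi : InConflict π p i) (hj : InConflict π p j) :
    IsRound π p (advance i (advance j p)) := by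
  refine ⟨{i, j}, by simp, by simp [hi, hj], fun t => ?_⟩
  by_cases h1 : t = i
  · subst h1; simp [hij]
  by_cases h2 : t = j
  · subst h2; simp [h1]
  · simp [h1, h2]

theorem support_subdivide {i j : Fin n} (hij : i ≠ j) {k l : ℕ} (hkl : π i k = π j l)
    (C : Chain n) {p : Config n} (hp : p ∈ (MusicalChairs.subdivide i j k l C).support) :
    ¬ (p i = k ∧ p j = l) ∧
      (p ∈ C.support ∨ ∃ p' ∈ C.support, (p' i = k ∧ p' j = l) ∧ IsRound π p' p) := by
  classical
  rw [MusicalChairs.subdivide, Finsupp.linearCombination_apply] at hp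
  obtain ⟨p', hp', h⟩ := Finset.mem_biUnion.1 (Finsupp.support_sum hp)
  have h := Finsupp.support_smul h
  split_ifs at h with hc
  · have hi : InConflict π p' i := ⟨j, hij.symm, by rw [hc.1, hc.2, hkl]⟩
    have hj : InConflict π p' j := ⟨i, hij, by rw [hc.1, hc.2, hkl]⟩
    have h' : p = advance i p' ∨ p = advance j p' ∨ p = advance i (advance j p') := by
      rcases Finset.mem_union.1 (Finsupp.support_add h) with h | h
      · rcases Finset.mem_union.1 (Finsupp.support_add h) with h | h
        · exact Or.inl (Finset.mem_singleton.1 (Finsupp.support_single_subset h))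
        · exact Or.inr (Or.inl (Finset.mem_singleton.1 (Finsupp.support_single_subset h)))
      · exact Or.inr (Or.inr (Finset.mem_singleton.1 (Finsupp.support_single_subset h)))
    rcases h' with rfl | rfl | rfl
    · exact ⟨by simp [hc], Or.inr ⟨p', hp', hc, isRound_advance hi⟩⟩
    · exact ⟨by simp [hc], Or.inr ⟨p', hp', hc, isRound_advance hj⟩⟩
    · exact ⟨by simp [hc, hij], Or.inr ⟨p', hp', hc, isRound_advance_advance hij hi hj⟩⟩
  · obtain rfl := Finset.mem_singleton.1 (Finsupp.support_single_subset h)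
    exact ⟨hc, Or.inl hp'⟩

/-- If a relative cycle has an odd number of monochromatic configurations, although there are
fewer than `n` chairs of each colour, then the strategy is not winning. -/
theorem IsRelCycle.not_isWinningStrategy {C : Chain n} (hC : IsRelCycle π C) {col : Fin m → Bool}
    (hcol : ∀ b, (Finset.univ.filter fun c => col c = b).card < n)
    (hmono : count (mono π col) C ≠ 0) : ¬ IsWinningStrategy π := by
  classical
  intro hwin
  let r : Config n → Config n → Prop := fun q p => IsRound π p q
  have : IsWellFounded (Config n) r := ⟨hwin.wellFounded⟩
  -- Subdivision trades configurations for ones of smaller rank, so the multiset of ranks drops in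
  -- the Dershowitz–Manna order.
  let ranks : Chain n → Multiset Ordinal.{0} := fun C => C.support.val.map (IsWellFounded.rank r)
  have hwf : WellFounded fun C C' : Chain n => (ranks C).IsDershowitzMannaLT (ranks C') :=
    InvImage.wf ranks Multiset.wellFounded_isDershowitzMannaLT
  induction C using hwf.induction with
  | _ C ih =>
    by_cases hterm : ∀ p ∈ C.support, IsTerminal π p
    · refine hmono ?_
      rw [Finsupp.linearCombination_apply]
      refine Finset.sum_eq_zero fun p hp => ?_
      have h0 : mono π col p = 0 := if_neg ?_
      · change C p • mono π col p = 0
        rw [h0, smul_zero]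
      rintro ⟨b, hb⟩
      have hinj : Function.Injective fun t => π t (p t) := by
        intro t u htu
        by_contra hne
        exact hterm p hp u ⟨t, hne, htu⟩
      have h1 := Finset.card_le_card_of_injOn (s := Finset.univ) (fun t => π t (p t))
        (t := Finset.univ.filter fun c => col c = b) (fun t _ => by simp [hb]) hinj.injOn
      rw [Finset.card_univ, Fintype.card_fin] at h1
      exact absurd (hcol b) (by omega)
    · simp only [IsTerminal, not_forall, not_not] at hterm
      obtain ⟨p, hp, i, j, hji, hkl⟩ := hterm
      refine ih (MusicalChairs.subdivide i j (p i) (p j) C) ?_ (hC.subdivide hji.symm hkl.symm)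
        (by rwa [hC.count_mono_subdivide col hji.symm hkl.symm])
      set C' := MusicalChairs.subdivide i j (p i) (p j) C
      have hsupp := fun q => support_subdivide (p := q) hji.symm hkl.symm C
      have hsplit : ∀ A B : Finset (Config n), A.val = (A ∩ B).val + (A \ B).val := by
        intro A B
        rw [← Finset.disjUnion_val _ _ (Finset.disjoint_sdiff_inter A B).symm,
          Finset.disjUnion_eq_union, Finset.union_comm, Finset.sdiff_union_inter]
      -- New configurations may cancel against old ones modulo two, so the common, gained and lost
      -- parts are read off from the two supports.
      refine ⟨(C'.support ∩ C.support).val.map (IsWellFounded.rank r),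
        (C'.support \ C.support).val.map (IsWellFounded.rank r),
        (C.support \ C'.support).val.map (IsWellFounded.rank r), ?_, ?_, ?_, ?_⟩
      · have h1 : p ∈ (C.support \ C'.support).val :=
          Finset.mem_sdiff.2 ⟨hp, fun h => (hsupp p h).1 ⟨rfl, rfl⟩⟩
        intro h
        have h2 := Multiset.mem_map_of_mem (IsWellFounded.rank r) h1
        rw [h] at h2
        exact Multiset.notMem_zero _ h2
      · rw [← Multiset.map_add, ← hsplit]
      · rw [Finset.inter_comm, ← Multiset.map_add, ← hsplit]
      · intro y hy
        obtain ⟨q, hq, rfl⟩ := Multiset.mem_map.1 hy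
        obtain ⟨hq1, hq2⟩ := Finset.mem_sdiff.1 hq
        obtain ⟨-, h | ⟨p', hp', hc, hr⟩⟩ := hsupp q hq1
        · exact absurd h hq2
        · exact ⟨_, Multiset.mem_map_of_mem _ (Finset.mem_sdiff.2 ⟨hp', fun h => (hsupp p' h).1 hc⟩),
            IsWellFounded.rank_lt_of_rel hr⟩

end Subdivision

/-! ### The starting chain for `2 * n - 2` chairs -/

theorem count_sum_single {n : ℕ} (φ : Config n → ZMod 2) (F : Finset (Config n)) :
    count φ (∑ p ∈ F, Finsupp.single p 1) = ∑ p ∈ F, φ p := by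
  simp

theorem card_colour_le (k : ℕ) (b : Bool) :
    (Finset.univ.filter fun c : Fin (2 * k + 2) => decide ((c : ℕ) ≤ k) = b).card ≤ k + 1 := by
  rw [← Finset.card_range (k + 1)]
  refine Finset.card_le_card_of_injOn (fun c => if (c : ℕ) ≤ k then (c : ℕ) else c - (k + 1))
    (fun c _ => ?_) fun c hc d hd h => Fin.ext ?_
  · have := c.2
    simp only [Finset.coe_range, Set.mem_Iio]
    split_ifs <;> omega
  · simp only [Finset.coe_filter, Finset.mem_univ, true_and, Set.mem_ofPred_eq] at hc hd
    have hcd : (c : ℕ) ≤ k ↔ (d : ℕ) ≤ k := by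
      rw [← hd] at hc
      exact decide_eq_decide.1 hc
    simp only [hcd] at h
    split_ifs at h with h1
    · exact h
    · omega

/-- With `2 * n - 2` chairs the scheduler wins: the last two players start at a common chair, and
each of the other players starts at one of two chairs of its own, of different colours. -/
theorem not_isWinningStrategy {k : ℕ} (π : Fin (k + 2) → Word (2 * k + 2)) :
    ¬ IsWinningStrategy π := by
  classical
  intro hwin
  choose idx hidx using hwin.1
  -- The `min` puts both players `k` and `k + 1` on chair `k`; player `i < k` owns the chairs `i`
  -- and `k + 1 + i`.
  let x : Fin (k + 2) → ℕ := fun i => idx i ⟨min (i : ℕ) k, by omega⟩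
  let y : Fin (k + 2) → ℕ := fun i => if h : (i : ℕ) < k then idx i ⟨k + 1 + i, by omega⟩ else x i
  have hx : ∀ i, (π i (x i) : ℕ) = min (i : ℕ) k := fun i => by simp only [x, hidx]
  have hy : ∀ i : Fin (k + 2), (i : ℕ) < k → (π i (y i) : ℕ) = k + 1 + i := fun i hi => by
    simp only [y, dif_pos hi, hidx]
  have hy' : ∀ i : Fin (k + 2), ¬ (i : ℕ) < k → y i = x i := fun i hi => by simp only [y, dif_neg hi]
  have hxy : ∀ i : Fin (k + 2), (i : ℕ) < k → x i ≠ y i := fun i hi h => by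
    have h1 := hx i
    rw [h, hy i hi] at h1
    omega
  let F : Finset (Config (k + 2)) := Fintype.piFinset fun i => {x i, y i}
  have hF : ∀ p, p ∈ F ↔ ∀ i, p i = x i ∨ p i = y i := fun p => by simp [F]
  let col : Fin (2 * k + 2) → Bool := fun c => decide ((c : ℕ) ≤ k)
  have hpos : ∀ p ∈ F, ∀ i : Fin (k + 2), (π i (p i) : ℕ) = min (i : ℕ) k ∨
      (i : ℕ) < k ∧ (π i (p i) : ℕ) = k + 1 + i := by
    intro p hp i
    rcases (hF p).1 hp i with h | h
    · left; rw [h, hx]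
    · by_cases hi : (i : ℕ) < k
      · right; exact ⟨hi, by rw [h, hy i hi]⟩
      · left; rw [h, hy' i hi, hx]
  have hcycle : IsRelCycle π (∑ p ∈ F, Finsupp.single p 1) := by
    rintro s q ⟨i, j, his, hjs, hij, hc⟩
    rw [count_sum_single]
    by_cases hs : (s : ℕ) < k
    -- Switching `s` between its two chairs pairs up the configurations on each face.
    · refine Finset.sum_involution
        (fun p _ => Function.update p s (if p s = x s then y s else x s)) ?_ ?_ ?_ ?_
      · intro p _
        rw [face_update, CharTwo.add_self_eq_zero]
      · intro p _ _ h
        have h1 := congrFun h s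
        rw [Function.update_self] at h1
        split_ifs at h1 with h2
        · exact hxy s hs (h2.symm.trans h1.symm)
        · exact h2 h1.symm
      · intro p hp
        rw [hF] at hp ⊢
        intro t
        by_cases ht : t = s
        · subst ht
          rw [Function.update_self]
          split_ifs <;> simp
        · rw [Function.update_of_ne ht]
          exact hp t
      · intro p hp
        rw [Function.update_self, Function.update_idem]
        rcases (hF p).1 hp s with h | h
        · rw [if_pos h, if_neg (hxy s hs).symm, ← h, Function.update_eq_self]
        · have h1 : p s ≠ x s := fun h1 => hxy s hs (h1.symm.trans h)
          rw [if_neg h1, if_pos rfl, ← h, Function.update_eq_self]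
    -- Without one of the last two players no conflict remains, so no configuration of `F` contains
    -- such a face.
    · refine Finset.sum_eq_zero fun p hp => if_neg fun h => ?_
      rw [← h i his, ← h j hjs] at hc
      have hc := congrArg Fin.val hc
      have hi := hpos p hp i
      have hj := hpos p hp j
      have h1 : (i : ℕ) ≠ s := fun h => his (Fin.ext h)
      have h2 : (j : ℕ) ≠ s := fun h => hjs (Fin.ext h)
      have h3 : (i : ℕ) ≠ j := fun h => hij (Fin.ext h)
      omega
  refine hcycle.not_isWinningStrategy (col := col)
    (fun b => Nat.lt_succ_of_le (card_colour_le k b)) ?_ hwin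
  -- The last player sits on chair `k`, which forces the colour `true` and hence the choice `x` for
  -- everyone.
  rw [count_sum_single, Finset.sum_eq_single x]
  · rw [mono, if_pos]
    · exact one_ne_zero
    · refine ⟨true, fun t => decide_eq_true ?_⟩
      rw [hx]; omega
  · intro p hp hne
    refine if_neg ?_
    rintro ⟨b, hb⟩
    refine hne (funext fun i => ?_)
    by_cases hi : (i : ℕ) < k
    · refine ((hF p).1 hp i).resolve_right fun h => ?_
      have h1 := hb i
      rw [← hb (Fin.last (k + 1))] at h1
      have h2 := decide_eq_decide.1 h1
      have h3 := hpos p hp (Fin.last (k + 1))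
      rw [h, hy i hi] at h2
      rw [Fin.val_last] at h3
      omega
    · rcases (hF p).1 hp i with h | h
      · exact h
      · rw [h, hy' i hi]
  · intro h
    exact absurd ((hF x).2 fun i => Or.inl rfl) h

end MusicalChairs

theorem theorem1 (n m : ℕ) :
    (∃ π : Fin n → MusicalChairs.Word m, MusicalChairs.IsWinningStrategy π) ↔ m ≥ 2 * n - 1 := by
  refine ⟨fun h => ?_, MusicalChairs.exists_isWinningStrategy⟩
  by_contra! hlt
  obtain ⟨π, hπ⟩ := h
  rcases Nat.lt_or_ge n 2 with hn | hn
  -- A single player without chairs has no word at all.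
  · obtain rfl : n = 1 := by omega
    obtain rfl : m = 0 := by omega
    exact (π 0 0).elim0
  · obtain ⟨k, rfl⟩ := Nat.exists_eq_add_of_le' hn
    obtain ⟨π', hπ'⟩ := MusicalChairs.exists_isWinningStrategy_of_le
      (show m ≤ 2 * k + 2 by omega) ⟨π, hπ⟩
    exact MusicalChairs.not_isWinningStrategy π' hπ'
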